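/- Let $\Bbbk$ be an algebraically closed field of characteristic $0$, let $\mathcal S=\Bbbk[X_0,\dots,X_n]$ and $\mathcal R=\Bbbk[Y_0,\dots,Y_n]$, and let $\mathcal R$ act on $\mathcal S$ by differentiation, $(G,F)\mapsto G\circ F$, with $Y_i$ acting as $\partial/\partial X_i$. Regard $\mathcal R$ as the homogeneous coordinate ring of $\mathbb P^n=\mathbb P(\mathcal S_1)$, and for a closed subscheme $Z\subset\mathbb P^n$ let $I(Z)\subseteq\mathcal R$ be its saturated homogeneous ideal. For a nonzero $L\in\mathcal S_1$ let $\wp_L\subset\mathcal R$ be the ideal of the point $[L]$, generated by the linear forms $G\in\mathcal R_1$ with $G\circ L=0$. A $0$-dimensional scheme $Z\subset\mathbb P^n$ is *apolar* to $F\in\mathcal S_d$ if $G\circ F=0$ for all $G\in I(Z)$; it is *irredundant* to $F$ if it is apolar to $F$ and no strict $0$-dimensional subscheme $Z'\subsetneq Z$ is apolar to $F$. Let $\mathrm{HF}_Z(i)=\dim_\Bbbk \mathcal R_i/(I(Z)\cap\mathcal R_i)$ and $\mathrm{reg}(Z)=\min\{i\in\mathbb N : \mathrm{HF}_Z(i)=\mathrm{HF}_Z(i+1)=\mathrm{len}(Z)\}$;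 $Z$ is *$d$-regular* if $\mathrm{reg}(Z)\le d$. **Corollary.** Let $d\ge 0$ and $F\in\mathcal S_d$, and let $L_1,\dots,L_s\in\mathcal S_1$ be $\Bbbk$-linearly independent linear forms. Let $Z=\bigcup_{i=1}^s Z_i\subset\mathbb P^n$ be a $0$-dimensional scheme that is apolar and irredundant to $F$, where $Z_1,\dots,Z_s\subset\mathbb P^n$ are $0$-dimensional schemes with $$I(Z_i)\supseteq \wp_{L_i}^{\lceil d/2\rceil+1}\qquad\text{for every } i\in\{1,\dots,s\}.$$ Then $Z$ is $d$-regular. -/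

import Mathlib

noncomputable section

namespace Apolarity

open MvPolynomial

attribute [local instance] MvPolynomial.gradedAlgebra

/-- The polynomial ring `S = k[X_0, …, X_n]`, whose linear forms `L` give the points `[L]` of
`ℙⁿ = ℙ(S_1)`. -/
abbrev PolyS (k : Type*) [Field k] (n : ℕ) := MvPolynomial (Fin (n + 1)) k

/-- The polynomial ring `R = k[Y_0, …, Y_n]`, the coordinate ring of `ℙⁿ = ℙ(S_1)`. -/
abbrev PolyR (k : Type*) [Field k] (n : ℕ) := MvPolynomial (Fin (n + 1)) k

/-- The apolarity action `(G, F) ↦ G ∘ F` of `R` on `S` by differentiation: the bilinear map with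
`Y^β ∘ X^α = α! / (α - β)! X^(α - β)` if `β ≤ α`, and `Y^β ∘ X^α = 0` otherwise. The integer
`α! / (α - β)!` is written as a product of falling factorials; it is `0` unless `β ≤ α`. -/
def diffAction (k : Type*) [Field k] (n : ℕ) : PolyR k n →ₗ[k] PolyS k n →ₗ[k] PolyS k n :=
  (basisMonomials (Fin (n + 1)) k).constr k fun β =>
    (basisMonomials (Fin (n + 1)) k).constr k fun α =>
      monomial (α - β) (∏ i, ((α i).descFactorial (β i) : k))

theorem diffAction_monomial {k : Type*} [Field k] {n : ℕ} (β α : Fin (n + 1) →₀ ℕ) (a b : k) :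
    diffAction k n (monomial β a) (monomial α b) =
      monomial (α - β) (a * b * ∏ i, ((α i).descFactorial (β i) : k)) := by
  have key : diffAction k n (monomial β 1) (monomial α 1) =
      monomial (α - β) (∏ i, ((α i).descFactorial (β i) : k)) := by
    have h1 := (basisMonomials (Fin (n + 1)) k).constr_basis k
      (fun β => (basisMonomials (Fin (n + 1)) k).constr k fun α =>
        monomial (α - β) (∏ i, ((α i).descFactorial (β i) : k))) β
    have h2 := (basisMonomials (Fin (n + 1)) k).constr_basis k
      (fun α => monomial (α - β) (∏ i, ((α i).descFactorial (β i) : k))) α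
    rw [coe_basisMonomials] at h1 h2
    rw [diffAction, h1, h2]
  have ha : (monomial β a : PolyR k n) = a • monomial β 1 := by simp [smul_monomial]
  have hb : (monomial α b : PolyS k n) = b • monomial α 1 := by simp [smul_monomial]
  rw [ha, hb, LinearMap.map_smul₂, LinearMap.map_smul, key]
  simp only [smul_monomial, smul_eq_mul, mul_assoc]

theorem diffAction_mul {k : Type*} [Field k] {n : ℕ} (G H : PolyR k n) (F : PolyS k n) :
    diffAction k n (G * H) F = diffAction k n G (diffAction k n H F) := by
  induction F using MvPolynomial.induction_on' with
  | add p q hp hq => simp only [map_add, hp, hq]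
  | monomial α c =>
    induction H using MvPolynomial.induction_on' with
    | add p q hp hq => simp only [mul_add, map_add, LinearMap.add_apply, hp, hq]
    | monomial β b =>
      induction G using MvPolynomial.induction_on' with
      | add p q hp hq => simp only [add_mul, map_add, LinearMap.add_apply, hp, hq]
      | monomial γ a =>
        rw [monomial_mul, diffAction_monomial, diffAction_monomial, diffAction_monomial]
        have h1 : α - (γ + β) = α - β - γ := by
          ext i; simp only [Finsupp.coe_tsub, Finsupp.coe_add, Pi.sub_apply, Pi.add_apply]; omega
        have h2 : (∏ i, ((α i).descFactorial ((γ + β) i) : k)) =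
            (∏ i, ((α i).descFactorial (β i) : k)) *
              ∏ i, (((α - β) i).descFactorial (γ i) : k) := by
          rw [← Finset.prod_mul_distrib]
          refine Finset.prod_congr rfl fun i _ => ?_
          rw [← Nat.cast_mul]
          congr 1
          have h3 := Nat.descFactorial_mul_descFactorial (n := α i) (k := β i)
            (m := γ i + β i) (by omega)
          rw [Finsupp.add_apply, ← h3, Nat.add_sub_cancel, mul_comm]
          rfl
        rw [h1, h2]
        congr 1
        ring

/-- The annihilator `Ann(F) = {G ∈ R : G ∘ F = 0}`, an ideal of `R`. -/
def ann {k : Type*} [Field k] {n : ℕ} (F : PolyS k n) : Ideal (PolyR k n) where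
  carrier := {G | diffAction k n G F = 0}
  add_mem' {a b} ha hb := by
    simp only [Set.mem_ofPred_eq] at ha hb ⊢
    rw [map_add, LinearMap.add_apply, ha, hb, add_zero]
  zero_mem' := by simp
  smul_mem' c x hx := by
    simp only [Set.mem_ofPred_eq] at hx ⊢
    rw [smul_eq_mul, diffAction_mul, hx, map_zero]

/-- The homogeneous ideal `℘_L ⊆ R` of the point `[L] ∈ ℙ(S_1)`: it is generated by the linear
forms of `R` that annihilate `L`, i.e. that vanish at the coordinate vector of `L`. The `j`-fat
point supported at `[L]` is defined by `℘_L ^ j`. -/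
def pointIdeal {k : Type*} [Field k] {n : ℕ} (L : PolyS k n) : Ideal (PolyR k n) :=
  Ideal.span {G | G.IsHomogeneous 1 ∧ diffAction k n G L = 0}

/-- A `0`-dimensional closed subscheme `Z` of `ℙⁿ`, given by its homogeneous ideal `I(Z) ⊆ R`.
Closed subschemes of `ℙⁿ` correspond bijectively to the homogeneous ideals of `R` that are
saturated with respect to `(Y_0, …, Y_n)`; the subscheme `Proj (R / I)` has dimension `0`
exactly when the ring `R / I` has Krull dimension `1`. -/
structure ZeroDimScheme (k : Type*) [Field k] (n : ℕ) where
  /-- the homogeneous ideal `I(Z)` -/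
  ideal : Ideal (PolyR k n)
  homogeneous : ideal.IsHomogeneous (homogeneousSubmodule (Fin (n + 1)) k)
  saturated : ∀ G : PolyR k n, (∀ i, X i * G ∈ ideal) → G ∈ ideal
  dim_eq_zero : ringKrullDim (PolyR k n ⧸ ideal) = 1

namespace ZeroDimScheme

variable {k : Type*} [Field k] {n : ℕ}

/-- `Z` is apolar to `F` if `I(Z) ⊆ Ann(F)`. -/
def IsApolar (Z : ZeroDimScheme k n) (F : PolyS k n) : Prop :=
  Z.ideal ≤ ann F

/-- `Z` is irredundant to `F`: it is apolar to `F`, and no strict `0`-dimensional subscheme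
`Z' ⊊ Z` (that is, `I(Z) ⊊ I(Z')`) is apolar to `F`. -/
def IsIrredundant (Z : ZeroDimScheme k n) (F : PolyS k n) : Prop :=
  Z.IsApolar F ∧ ¬ ∃ Z' : ZeroDimScheme k n, Z.ideal < Z'.ideal ∧ Z'.IsApolar F

/-- The Hilbert function `HF_Z(i) = dim_k R_i / I(Z)_i`, where `I(Z)_i = I(Z) ∩ R_i`. -/
def hilbertFunction (Z : ZeroDimScheme k n) (i : ℕ) : ℕ :=
  Module.finrank k (homogeneousSubmodule (Fin (n + 1)) k i ⧸
    (Z.ideal.restrictScalars k).comap (homogeneousSubmodule (Fin (n + 1)) k i).subtype)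

/-- The length of `Z`, i.e. the dimension over `k` of the ring of functions on `Z`.
For a linear form `ℓ ∈ R_1`, the part of `Z` in the affine chart `{ℓ ≠ 0}` of `ℙⁿ` is the affine
scheme with coordinate ring `R / (I(Z) + (ℓ - 1))`, which is all of `Z` as soon as the hyperplane
`{ℓ = 0}` misses the finitely many points of `Z`; over an infinite field there is such an `ℓ`, so
that the supremum of the dimensions of these coordinate rings is the length of `Z`. -/
def length (Z : ZeroDimScheme k n) : ℕ∞ :=
  ⨆ (l : PolyR k n) (_ : l.IsHomogeneous 1),
    Module.length k (PolyR k n ⧸ (Z.ideal ⊔ Ideal.span {l - 1}))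

/-- The regularity of `Z`, the least `i` with `HF_Z(i) = HF_Z(i + 1) = len(Z)`
(`⊤` if there were none). -/
def regularity (Z : ZeroDimScheme k n) : ℕ∞ :=
  ⨅ (i : ℕ) (_ : (Z.hilbertFunction i : ℕ∞) = Z.length ∧
    (Z.hilbertFunction (i + 1) : ℕ∞) = Z.length), (i : ℕ∞)

/-- `Z` is `d`-regular if its regularity is at most `d`. -/
def IsRegularInDegree (Z : ZeroDimScheme k n) (d : ℕ) : Prop :=
  Z.regularity ≤ d

end ZeroDimScheme

end Apolarity

end

/-!
Let `l` be the sum of linear forms dual to the `L i`. The hyperplane `l = 0` misses the points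
`[L i]`, so `Z` is an affine scheme with coordinate ring `A = R / (I(Z) + (l - 1))`, and `Z` is
`d`-regular as soon as the image `V` of the forms of degree `d` is all of `A`. Since the points are
independent, the ideal `N` of the reduced scheme is generated by forms of degree at most two, so
that `V + N ^ m = A` when `2 * m ≤ d + 1`, while `N ^ (m + 1) = 0`. Differentiation of `F` gives a
linear form on `V`, and irredundancy says that no nonzero proper ideal of `A` lies in the kernel of
any extension of it to `A`. A nonzero form vanishing on `V` would give a whole line of extensions,
which forces it to vanish on `N ^ m` too.
-/

namespace Apolarity

open MvPolynomial

attribute [local instance] MvPolynomial.gradedAlgebra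

section FrobeniusForm

variable {k A : Type*} [Field k] [CommRing A] [Algebra k A]

/-- A linear form `φ` on a commutative algebra `A` is a Frobenius form if its kernel contains no
nonzero ideal. If `A` is finite-dimensional, this says that `φ` generates the `A`-module dual to
`A`. -/
def IsFrobeniusForm (φ : A →ₗ[k] k) : Prop :=
  ∀ K : Ideal A, K.restrictScalars k ≤ LinearMap.ker φ → K = ⊥

theorem IsFrobeniusForm.eq_zero_of_forall_mul {φ : A →ₗ[k] k} (hφ : IsFrobeniusForm φ) {a : A}
    (ha : ∀ x, φ (a * x) = 0) : a = 0 := by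
  refine Ideal.span_singleton_eq_bot.1 (hφ _ fun x hx => ?_)
  obtain ⟨z, rfl⟩ := Ideal.mem_span_singleton.1 hx
  exact ha z

theorem IsFrobeniusForm.exists_forall_eq_mul [FiniteDimensional k A] {φ : A →ₗ[k] k}
    (hφ : IsFrobeniusForm φ) (ψ : A →ₗ[k] k) : ∃ a : A, ∀ x, ψ x = φ (a * x) := by
  let B : A →ₗ[k] Module.Dual k A := (LinearMap.mul k A).compr₂ φ
  have hinj : Function.Injective B := (injective_iff_map_eq_zero B).2 fun _ hb =>
    hφ.eq_zero_of_forall_mul (LinearMap.congr_fun hb)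
  have hsurj : Function.Surjective B :=
    (LinearMap.injective_iff_surjective_of_finrank_eq_finrank
      Subspace.dual_finrank_eq.symm).1 hinj
  obtain ⟨a, rfl⟩ := hsurj ψ
  exact ⟨a, fun _ => rfl⟩

theorem isUnit_of_isFrobeniusForm_comp_mulLeft [FiniteDimensional k A] (φ : A →ₗ[k] k) {u : A}
    (hu : IsFrobeniusForm (φ ∘ₗ LinearMap.mulLeft k u)) : IsUnit u := by
  have hinj : Function.Injective (LinearMap.mulLeft k u) :=
    (injective_iff_map_eq_zero _).2 fun b (hb : u * b = 0) =>
      hu.eq_zero_of_forall_mul fun x => by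
        rw [LinearMap.comp_apply, LinearMap.mulLeft_apply, ← mul_assoc, hb, zero_mul, map_zero]
  obtain ⟨v, hv⟩ := LinearMap.injective_iff_surjective.1 hinj 1
  exact IsUnit.of_mul_eq_one v hv

/-- If `V ≠ ⊤`, pick `ψ ≠ 0` vanishing on `V` and write `ψ = f(a ·)`. All the forms
`f + c ψ = f((1 + c a) ·)` are Frobenius forms, so every `1 + c a` is a unit and `a ∈ N`; but then
`ψ` vanishes on `N ^ m` as well. -/
theorem eq_top_of_forall_isFrobeniusForm [FiniteDimensional k A] {N : Ideal A} {m : ℕ}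
    (hN : N ^ (m + 1) = ⊥) (hunit : ∀ a : A, (∀ c : k, IsUnit (1 + c • a)) → a ∈ N)
    {V : Submodule k A} (hV : V ⊔ (N ^ m).restrictScalars k = ⊤) (f : A →ₗ[k] k)
    (hf : ∀ φ : A →ₗ[k] k, Set.EqOn φ f V → IsFrobeniusForm φ) : V = ⊤ := by
  by_contra hne
  obtain ⟨ψ, hψ, hVψ⟩ := V.exists_le_ker_of_lt_top (lt_top_iff_ne_top.2 hne)
  obtain ⟨a, ha⟩ := (hf f fun _ _ => rfl).exists_forall_eq_mul ψ
  have haN : a ∈ N := hunit a fun c => by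
    refine isUnit_of_isFrobeniusForm_comp_mulLeft f (hf _ fun x hx => ?_)
    have hψx : f (a * x) = 0 := by rw [← ha]; exact hVψ hx
    simp [add_mul, hψx]
  have hNψ : (N ^ m).restrictScalars k ≤ LinearMap.ker ψ := fun x hx => by
    have hax : a * x ∈ N ^ (m + 1) := pow_succ' N m ▸ Ideal.mul_mem_mul haN hx
    rw [hN, Ideal.mem_bot] at hax
    rw [LinearMap.mem_ker, ha, hax, map_zero]
  exact hψ (LinearMap.ker_eq_top.1 (top_le_iff.1 (hV ▸ sup_le hVψ hNψ)))

theorem eq_top_of_forall_ideal_eq_bot {N : Ideal A} (hN : IsNilpotent N)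
    (hunit : ∀ a : A, (∀ c : k, IsUnit (1 + c • a)) → a ∈ N)
    (hA : ∀ K : Ideal A, K ≠ ⊤ → K = ⊥) {V : Submodule k A} (hV : 1 ∈ V) : V = ⊤ := by
  have hNbot : N = ⊥ := by
    by_cases htop : N = ⊤
    · obtain ⟨m, hm⟩ := hN
      rwa [htop, Ideal.top_pow, ← htop] at hm
    · exact hA N htop
  refine eq_top_iff.2 fun a _ => ?_
  by_cases ha : ∀ c : k, IsUnit (1 + c • a)
  · have ha0 := hunit a ha
    rw [hNbot, Ideal.mem_bot] at ha0
    exact ha0 ▸ V.zero_mem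
  · obtain ⟨c, hc⟩ := not_forall.1 ha
    have hc0 : c ≠ 0 := by rintro rfl; simp at hc
    have h : 1 + c • a = 0 :=
      Ideal.span_singleton_eq_bot.1 (hA _ (mt Ideal.span_singleton_eq_top.1 hc))
    rw [← inv_smul_smul₀ hc0 a, eq_neg_of_add_eq_zero_right h]
    exact V.smul_mem _ (V.neg_mem hV)

theorem eq_top_of_forall_extension [FiniteDimensional k A] {N : Ideal A} {m : ℕ}
    (hN : N ^ (m + 1) = ⊥) (hunit : ∀ a : A, (∀ c : k, IsUnit (1 + c • a)) → a ∈ N)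
    {V : Submodule k A} (hone : 1 ∈ V) (hV : V ⊔ (N ^ m).restrictScalars k = ⊤) (f : A →ₗ[k] k)
    (hf : ∀ φ : A →ₗ[k] k, Set.EqOn φ f V →
      ∀ K : Ideal A, K ≠ ⊤ → K.restrictScalars k ≤ LinearMap.ker φ → K = ⊥) : V = ⊤ := by
  by_cases hfV : V ≤ LinearMap.ker f
  · exact eq_top_of_forall_ideal_eq_bot ⟨m + 1, hN⟩ hunit
      (fun K hK => hf 0 (fun x hx => (hfV hx).symm) K hK (by simp)) hone
  · refine eq_top_of_forall_isFrobeniusForm hN hunit hV f fun φ hφ K hKφ => hf φ hφ K ?_ hKφ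
    rintro rfl
    exact hfV fun x hx => (hφ hx).symm.trans (hKφ Submodule.mem_top)

end FrobeniusForm

section SpanOfIdempotents

variable {k B ι : Type*} {e : ι → B}

theorem eq_zero_of_forall_isUnit_one_add_smul [Finite ι] [Field k] [Ring B] [Algebra k B]
    (he : OrthogonalIdempotents e) (hspan : Submodule.span k (Set.range e) = ⊤) {b : B}
    (hb : ∀ c : k, IsUnit (1 + c • b)) : b = 0 := by
  classical
  cases nonempty_fintype ι
  obtain ⟨c, rfl⟩ : ∃ c : ι → k, ∑ i, c i • e i = b :=
    (Submodule.mem_span_range_iff_exists_fun k).1 (hspan ▸ Submodule.mem_top)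
  refine Finset.sum_eq_zero fun j _ => ?_
  by_cases hc : c j = 0
  · rw [hc, zero_smul]
  have hbe : (∑ i, c i • e i) * e j = c j • e j := by
    simp [Finset.sum_mul, he.mul_eq]
  have h : (1 + (-(c j)⁻¹) • ∑ i, c i • e i) * e j = 0 := by
    rw [add_mul, one_mul, smul_mul_assoc, hbe, neg_smul, inv_smul_smul₀ hc, add_neg_cancel]
  rw [(hb _).mul_right_eq_zero.1 h, smul_zero]

theorem span_range_eq_top_of_le [Fintype ι] [CommSemiring k] [Semiring B] [Algebra k B]
    (he : CompleteOrthogonalIdempotents e) {s : Set B} (hs : Algebra.adjoin k s = ⊤)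
    (hse : s ⊆ Submodule.span k (Set.range e)) : Submodule.span k (Set.range e) = ⊤ := by
  classical
  have hone : 1 ∈ Submodule.span k (Set.range e) :=
    he.complete ▸ sum_mem fun i _ => Submodule.subset_span ⟨i, rfl⟩
  have hmul : Submodule.span k (Set.range e) * Submodule.span k (Set.range e) ≤
      Submodule.span k (Set.range e) := by
    rw [Submodule.span_mul_span, Submodule.span_le]
    rintro _ ⟨_, ⟨i, rfl⟩, _, ⟨j, rfl⟩, rfl⟩
    change e i * e j ∈ _
    rw [he.mul_eq]
    split_ifs
    · exact Submodule.subset_span ⟨i, rfl⟩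
    · exact zero_mem _
  let S : Subalgebra k B := (Submodule.span k (Set.range e)).toSubalgebra hone
    fun x y hx hy => hmul (Submodule.mul_mem_mul hx hy)
  have hS : S = ⊤ := top_le_iff.1 (hs ▸ Algebra.adjoin_le hse)
  exact eq_top_iff.2 fun x _ => (hS ▸ Algebra.mem_top : x ∈ S)

end SpanOfIdempotents

section PowersOfIdeals

variable {k A : Type*} [CommSemiring k] [CommSemiring A] [Algebra k A]
  {V : Submodule k A} {T : Set A}

theorem span_pow_le_pow_sup_span_pow (hT : T ⊆ (V ^ 2 : Submodule k A))
    (hV : V ⊔ (Ideal.span T).restrictScalars k = ⊤) (q : ℕ) :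
    (Ideal.span T ^ q).restrictScalars k ≤
      V ^ (2 * q + 1) ⊔ (Ideal.span T ^ (q + 1)).restrictScalars k := by
  intro x hx
  rw [Submodule.restrictScalars_mem, Ideal.span, Submodule.span_pow] at hx
  induction hx using Submodule.closure_induction with
  | zero => exact zero_mem _
  | add x y _ _ hx hy => exact add_mem hx hy
  | smul_mem a t ht =>
    have ha : a ∈ V ⊔ (Ideal.span T).restrictScalars k := hV ▸ Submodule.mem_top
    obtain ⟨v, hv, w, hw, rfl⟩ := Submodule.mem_sup.1 ha
    have htV : t ∈ V ^ (2 * q) := by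
      rw [pow_mul]
      exact Submodule.pow_subset_pow _ (Set.pow_subset_pow_left hT ht)
    have htT : t ∈ Ideal.span T ^ q := by
      rw [Ideal.span, Submodule.span_pow]
      exact Submodule.subset_span ht
    rw [add_smul, smul_eq_mul, smul_eq_mul]
    refine Submodule.add_mem_sup ?_ ?_
    · rw [pow_succ, mul_comm v]
      exact Submodule.mul_mem_mul htV hv
    · rw [Submodule.restrictScalars_mem, pow_succ, mul_comm w]
      exact Ideal.mul_mem_mul htT hw

theorem pow_sup_span_pow_eq_top (hone : 1 ∈ V) (hT : T ⊆ (V ^ 2 : Submodule k A))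
    (hV : V ⊔ (Ideal.span T).restrictScalars k = ⊤) {e q : ℕ} (hqe : 2 * q ≤ e + 1) :
    V ^ e ⊔ (Ideal.span T ^ q).restrictScalars k = ⊤ := by
  induction q with
  | zero => simp
  | succ q ih =>
    have hpow : V ^ (2 * q + 1) ≤ V ^ e :=
      pow_le_pow_right₀ (Submodule.one_le.2 hone) (by omega)
    rw [eq_top_iff, ← ih (by omega)]
    exact sup_le le_sup_left
      ((span_pow_le_pow_sup_span_pow hT hV q).trans (sup_le_sup_right hpow _))

end PowersOfIdeals

section Homogenization

variable {σ k : Type*} [CommRing k]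

/-- The homogenization of a polynomial of degree at most `N` to a form of degree `N`, with respect
to a linear form `l`. Components of degree greater than `N` are discarded, which makes the map
linear. -/
noncomputable def homogenize (l : MvPolynomial σ k) (N : ℕ) :
    MvPolynomial σ k →ₗ[k] MvPolynomial σ k :=
  ∑ t ∈ Finset.range (N + 1), LinearMap.mulLeft k (l ^ (N - t)) ∘ₗ homogeneousComponent t

variable {l G : MvPolynomial σ k} {N t : ℕ}

theorem homogenize_apply (l : MvPolynomial σ k) (N : ℕ) (G : MvPolynomial σ k) :
    homogenize l N G = ∑ t ∈ Finset.range (N + 1), l ^ (N - t) * homogeneousComponent t G := by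
  simp [homogenize]

theorem homogenize_of_isHomogeneous (l : MvPolynomial σ k) (hG : G.IsHomogeneous t) (ht : t ≤ N) :
    homogenize l N G = l ^ (N - t) * G := by
  rw [homogenize_apply, Finset.sum_eq_single_of_mem t (Finset.mem_range.2 (by omega)),
    homogeneousComponent_eq_self hG]
  intro u _ hu
  rw [homogeneousComponent_of_mem hG, if_neg hu, mul_zero]

theorem isHomogeneous_homogenize (hl : l.IsHomogeneous 1) (N : ℕ) (G : MvPolynomial σ k) :
    (homogenize l N G).IsHomogeneous N := by
  rw [homogenize_apply]
  refine IsHomogeneous.sum _ _ _ fun t ht => ?_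
  have h := (hl.pow (N - t)).mul (homogeneousComponent_isHomogeneous t G)
  rwa [one_mul, Nat.sub_add_cancel (Nat.lt_succ_iff.1 (Finset.mem_range.1 ht))] at h

theorem sub_homogenize_mem_span (l : MvPolynomial σ k) (hG : G.totalDegree ≤ N) :
    G - homogenize l N G ∈ Ideal.span {l - 1} := by
  have hsum : G = ∑ t ∈ Finset.range (N + 1), homogeneousComponent t G := by
    conv_lhs => rw [← sum_homogeneousComponent G]
    refine Finset.sum_subset (by simpa using hG) fun t _ ht => ?_
    exact homogeneousComponent_eq_zero _ _ (by simpa using ht)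
  rw [homogenize_apply]
  nth_rw 1 [hsum]
  rw [← Finset.sum_sub_distrib]
  refine Ideal.sum_mem _ fun t _ => ?_
  rw [← one_sub_mul, ← neg_sub (l ^ _), neg_mul, Ideal.mem_span_singleton, dvd_neg]
  exact (sub_one_dvd_pow_sub_one l _).mul_right _

theorem homogenize_sub_one_mul (hl : l.IsHomogeneous 1) (hG : G.totalDegree < N) :
    homogenize l N ((l - 1) * G) = 0 := by
  rw [← sum_homogeneousComponent G, Finset.mul_sum, map_sum]
  refine Finset.sum_eq_zero fun t ht => ?_
  have htN : t < N := (Nat.lt_succ_iff.1 (Finset.mem_range.1 ht)).trans_lt hG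
  have hGt := homogeneousComponent_isHomogeneous t G
  rw [sub_mul, one_mul, map_sub, homogenize_of_isHomogeneous l hGt htN.le,
    homogenize_of_isHomogeneous l (hl.mul hGt) (by omega), ← mul_assoc, ← pow_succ,
    show N - (1 + t) + 1 = N - t by omega, sub_self]

theorem homogenize_mem {I : Ideal (MvPolynomial σ k)}
    (hI : I.IsHomogeneous (homogeneousSubmodule σ k)) (l : MvPolynomial σ k) (N : ℕ)
    (hG : G ∈ I) : homogenize l N G ∈ I := by
  rw [homogenize_apply]
  exact I.sum_mem fun t _ => I.mul_mem_left _ (homogeneousComponent_mem_of_mem hI hG t)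

/-- Homogenizing a relation `G = a + (l - 1) b` with `a ∈ I` in a large degree kills the second
summand and turns `G` into `l ^ r * G`. -/
theorem mem_of_mem_sup_span_sub_one {I : Ideal (MvPolynomial σ k)}
    (hI : I.IsHomogeneous (homogeneousSubmodule σ k)) (hl : l.IsHomogeneous 1)
    (hreg : IsSMulRegular (MvPolynomial σ k ⧸ I) l) (hG : G.IsHomogeneous t)
    (hmem : G ∈ I ⊔ Ideal.span {l - 1}) : G ∈ I := by
  obtain ⟨a, ha, c, hc, rfl⟩ := Submodule.mem_sup.1 hmem
  obtain ⟨b, rfl⟩ := Ideal.mem_span_singleton.1 hc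
  have hmem : homogenize l (b.totalDegree + 1 + t) (a + (l - 1) * b) ∈ I := by
    rw [map_add, homogenize_sub_one_mul hl (by omega), add_zero]
    exact homogenize_mem hI l _ ha
  rw [homogenize_of_isHomogeneous l hG (by omega)] at hmem
  exact mem_of_isSMulRegular_quotient_of_smul_mem (hreg.pow _) hmem

end Homogenization

section Chart

variable {σ k : Type*} [CommRing k]

/-- The coordinate ring of the part of the scheme defined by `I` in the affine chart `l ≠ 0`, for
a linear form `l`. -/
noncomputable abbrev chartRing (I : Ideal (MvPolynomial σ k)) (l : MvPolynomial σ k) : Type _ :=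
  MvPolynomial σ k ⧸ (I ⊔ Ideal.span {l - 1})

/-- Dehomogenization: restriction of polynomials to the chart `l ≠ 0`, where `l` becomes `1`. -/
noncomputable abbrev chartMap (I : Ideal (MvPolynomial σ k)) (l : MvPolynomial σ k) :
    MvPolynomial σ k →ₐ[k] chartRing I l :=
  Ideal.Quotient.mkₐ k (I ⊔ Ideal.span {l - 1})

/-- The image of the forms of degree `i` in the coordinate ring of the chart `l ≠ 0`. -/
noncomputable def formsInChart (I : Ideal (MvPolynomial σ k)) (l : MvPolynomial σ k) (i : ℕ) :
    Submodule k (chartRing I l) :=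
  (homogeneousSubmodule σ k i).map (chartMap I l).toLinearMap

variable (I : Ideal (MvPolynomial σ k)) {l G : MvPolynomial σ k} {i : ℕ}

theorem chartMap_surjective (l : MvPolynomial σ k) : Function.Surjective (chartMap I l) :=
  Ideal.Quotient.mkₐ_surjective _ _

theorem chartMap_eq_zero_iff : chartMap I l G = 0 ↔ G ∈ I ⊔ Ideal.span {l - 1} :=
  Ideal.Quotient.eq_zero_iff_mem

theorem chartMap_self (l : MvPolynomial σ k) : chartMap I l l = 1 := by
  rw [← sub_eq_zero, ← map_one (chartMap I l), ← map_sub, chartMap_eq_zero_iff]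
  exact le_sup_right (a := I) (Ideal.mem_span_singleton_self _)

theorem chartMap_homogenize (hG : G.totalDegree ≤ i) :
    chartMap I l (homogenize l i G) = chartMap I l G := by
  rw [eq_comm, ← sub_eq_zero, ← map_sub, chartMap_eq_zero_iff]
  exact le_sup_right (a := I) (sub_homogenize_mem_span l hG)

theorem chartMap_mem_formsInChart (hl : l.IsHomogeneous 1) (hG : G.totalDegree ≤ i) :
    chartMap I l G ∈ formsInChart I l i :=
  ⟨homogenize l i G, isHomogeneous_homogenize hl i G, chartMap_homogenize I hG⟩

theorem formsInChart_mono (hl : l.IsHomogeneous 1) : Monotone (formsInChart I l) := by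
  rintro i j hij _ ⟨G, hG, rfl⟩
  exact chartMap_mem_formsInChart I hl ((IsHomogeneous.totalDegree_le hG).trans hij)

theorem one_mem_formsInChart (hl : l.IsHomogeneous 1) (i : ℕ) : 1 ∈ formsInChart I l i := by
  have h := chartMap_mem_formsInChart I hl (G := 1) (i := i) (by simp)
  rwa [map_one] at h

theorem formsInChart_one_pow (l : MvPolynomial σ k) (i : ℕ) :
    formsInChart I l 1 ^ i = formsInChart I l i := by
  rw [formsInChart, formsInChart, ← Submodule.map_pow, homogeneousSubmodule_one_pow]

instance finite_homogeneousSubmodule [Finite σ] (i : ℕ) :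
    Module.Finite k (homogeneousSubmodule σ k i) :=
  Module.Finite.iff_fg.2 (homogeneousSubmodule_fg _ _ i)

instance finite_formsInChart [Finite σ] (l : MvPolynomial σ k) (i : ℕ) :
    Module.Finite k (formsInChart I l i) :=
  inferInstanceAs (Module.Finite k (Submodule.map _ _))

theorem exists_subset_formsInChart (hl : l.IsHomogeneous 1) (s : Finset (chartRing I l)) :
    ∃ i, (s : Set (chartRing I l)) ⊆ formsInChart I l i := by
  choose g hg using chartMap_surjective I l
  refine ⟨s.sup fun x => (g x).totalDegree, fun x hx => ?_⟩
  rw [← hg x]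
  exact chartMap_mem_formsInChart I hl (Finset.le_sup (f := fun x => (g x).totalDegree) hx)

theorem formsInChart_sup_map_pow_eq_top (hl : l.IsHomogeneous 1) {T : Set (MvPolynomial σ k)}
    (hT : ∀ w ∈ T, w.totalDegree ≤ 2)
    (hV : formsInChart I l 1 ⊔ ((Ideal.span T).map (chartMap I l)).restrictScalars k = ⊤)
    {e q : ℕ} (hqe : 2 * q ≤ e + 1) :
    formsInChart I l e ⊔ ((Ideal.span T).map (chartMap I l) ^ q).restrictScalars k = ⊤ := by
  rw [Ideal.map_span] at hV ⊢
  rw [← formsInChart_one_pow]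
  refine pow_sup_span_pow_eq_top (one_mem_formsInChart I hl 1) ?_ hV hqe
  rintro _ ⟨w, hw, rfl⟩
  rw [formsInChart_one_pow]
  exact chartMap_mem_formsInChart I hl (hT w hw)

end Chart

namespace ZeroDimScheme

variable {k : Type*} [Field k] {n : ℕ} (Z : ZeroDimScheme k n)

/-- The restriction of forms of degree `i` to the chart `l ≠ 0`. -/
noncomputable def chartMapOnForms (l : PolyR k n) (i : ℕ) :
    homogeneousSubmodule (Fin (n + 1)) k i →ₗ[k] chartRing Z.ideal l :=
  (chartMap Z.ideal l).toLinearMap ∘ₗ Submodule.subtype _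

theorem range_chartMapOnForms (l : PolyR k n) (i : ℕ) :
    LinearMap.range (Z.chartMapOnForms l i) = formsInChart Z.ideal l i := by
  rw [chartMapOnForms, LinearMap.range_comp, Submodule.range_subtype, formsInChart]

theorem comap_subtype_le_ker_chartMapOnForms (l : PolyR k n) (i : ℕ) :
    (Z.ideal.restrictScalars k).comap (homogeneousSubmodule (Fin (n + 1)) k i).subtype ≤
      LinearMap.ker (Z.chartMapOnForms l i) :=
  fun _ hG => (chartMap_eq_zero_iff Z.ideal).2 (Ideal.mem_sup_left hG)

variable {Z} {l : PolyR k n}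

theorem ker_chartMapOnForms (hl : l.IsHomogeneous 1)
    (hreg : IsSMulRegular (PolyR k n ⧸ Z.ideal) l) (i : ℕ) :
    LinearMap.ker (Z.chartMapOnForms l i) =
      (Z.ideal.restrictScalars k).comap (homogeneousSubmodule (Fin (n + 1)) k i).subtype :=
  le_antisymm
    (fun G hG => mem_of_mem_sup_span_sub_one Z.homogeneous hl hreg G.2
      ((chartMap_eq_zero_iff Z.ideal).1 hG))
    (Z.comap_subtype_le_ker_chartMapOnForms l i)

theorem hilbertFunction_eq_finrank_formsInChart (hl : l.IsHomogeneous 1)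
    (hreg : IsSMulRegular (PolyR k n ⧸ Z.ideal) l) (i : ℕ) :
    Z.hilbertFunction i = Module.finrank k (formsInChart Z.ideal l i) := by
  rw [hilbertFunction, ← ker_chartMapOnForms hl hreg, ← range_chartMapOnForms]
  exact (Z.chartMapOnForms l i).quotKerEquivRange.finrank_eq

variable (Z) in
theorem finrank_formsInChart_le_hilbertFunction (l : PolyR k n) (i : ℕ) :
    Module.finrank k (formsInChart Z.ideal l i) ≤ Z.hilbertFunction i := by
  rw [← range_chartMapOnForms, ← Submodule.range_liftQ _ _
    (Z.comap_subtype_le_ker_chartMapOnForms l i)]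
  exact LinearMap.finrank_range_le _

theorem length_le_of_forall_hilbertFunction_le {r : ℕ} (hr : ∀ i, Z.hilbertFunction i ≤ r) :
    Z.length ≤ r := by
  refine iSup₂_le fun l hl => ?_
  have hrank : Module.rank k (chartRing Z.ideal l) ≤ r := rank_le fun s hs => by
    obtain ⟨i, hi⟩ := exists_subset_formsInChart Z.ideal hl s
    rw [← finrank_span_finset_eq_card hs]
    exact (Submodule.finrank_mono (Submodule.span_le.2 hi)).trans
      ((Z.finrank_formsInChart_le_hilbertFunction l i).trans (hr i))
  rw [Module.length_eq_rank]
  simpa using Cardinal.toENat.monotone' hrank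

theorem length_eq_hilbertFunction_of_formsInChart_eq_top (hl : l.IsHomogeneous 1)
    (hreg : IsSMulRegular (PolyR k n ⧸ Z.ideal) l) {i : ℕ} (hi : formsInChart Z.ideal l i = ⊤) :
    Z.length = Z.hilbertFunction i := by
  have hfin : FiniteDimensional k (chartRing Z.ideal l) :=
    Module.finite_def.2 (hi ▸ Module.Finite.iff_fg.1 (finite_formsInChart Z.ideal l i))
  have hHF : Z.hilbertFunction i = Module.finrank k (chartRing Z.ideal l) := by
    rw [hilbertFunction_eq_finrank_formsInChart hl hreg, hi, finrank_top]
  refine le_antisymm (length_le_of_forall_hilbertFunction_le fun j => ?_) ?_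
  · rw [hHF, hilbertFunction_eq_finrank_formsInChart hl hreg]
    exact Submodule.finrank_le _
  · rw [hHF, ← Module.length_eq_finrank]
    exact le_iSup₂ (f := fun (l : PolyR k n) (_ : l.IsHomogeneous 1) =>
      Module.length k (chartRing Z.ideal l)) l hl

theorem isRegularInDegree_of_formsInChart_eq_top (hl : l.IsHomogeneous 1)
    (hreg : IsSMulRegular (PolyR k n ⧸ Z.ideal) l) {d : ℕ} (hd : formsInChart Z.ideal l d = ⊤) :
    Z.IsRegularInDegree d := by
  have hd' : formsInChart Z.ideal l (d + 1) = ⊤ :=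
    top_le_iff.1 (hd ▸ formsInChart_mono Z.ideal hl d.le_succ)
  exact iInf₂_le d ⟨(length_eq_hilbertFunction_of_formsInChart_eq_top hl hreg hd).symm,
    (length_eq_hilbertFunction_of_formsInChart_eq_top hl hreg hd').symm⟩

end ZeroDimScheme

section HomogeneousCore

variable {σ k : Type*}

theorem linear_form_mem_span_X [CommSemiring k] {l : MvPolynomial σ k} (hl : l.IsHomogeneous 1) :
    l ∈ Ideal.span (Set.range (X : σ → MvPolynomial σ k)) := by
  rw [← mem_homogeneousSubmodule, homogeneousSubmodule_one_eq_span_X] at hl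
  exact Submodule.span_subset_span k _ _ hl

theorem linear_form_mul_mem [CommSemiring k] {I : Ideal (MvPolynomial σ k)} {l G : MvPolynomial σ k}
    (hl : l.IsHomogeneous 1) (hG : ∀ i, X i * G ∈ I) : l * G ∈ I := by
  have hX : Ideal.span (Set.range X) ≤ I.colon {G} :=
    Ideal.span_le.2 (Set.range_subset_iff.2 fun i => Submodule.mem_colon_singleton.2 (hG i))
  exact Submodule.mem_colon_singleton.1 (hX (linear_form_mem_span_X hl))

theorem homogeneousComponent_linear_form_mul [CommSemiring k] {l : MvPolynomial σ k}
    (hl : l.IsHomogeneous 1) (t : ℕ) (G : MvPolynomial σ k) :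
    homogeneousComponent (1 + t) (l * G) = l * homogeneousComponent t G := by
  rw [← decomposition.decompose'_apply, ← decomposition.decompose'_apply]
  exact DirectSum.coe_decompose_mul_add_of_left_mem (homogeneousSubmodule σ k) hl

theorem mem_homogeneousCore_iff [CommSemiring k] {P : Ideal (MvPolynomial σ k)}
    {G : MvPolynomial σ k} :
    G ∈ (P.homogeneousCore (homogeneousSubmodule σ k)).toIdeal ↔
      ∀ t, homogeneousComponent t G ∈ P := by
  rw [mem_iff_homogeneousComponent_mem (HomogeneousIdeal.isHomogeneous _)]
  exact forall_congr' fun t => ⟨fun hG => Ideal.toIdeal_homogeneousCore_le _ P hG,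
    Ideal.mem_homogeneousCore_of_homogeneous_of_mem ⟨t, homogeneousComponent_isHomogeneous t G⟩⟩

variable [CommRing k] {P : Ideal (MvPolynomial σ k)} {l : MvPolynomial σ k}

theorem isSMulRegular_quotient_homogeneousCore (hl : l.IsHomogeneous 1) (hlP : l - 1 ∈ P) :
    IsSMulRegular
      (MvPolynomial σ k ⧸ (P.homogeneousCore (homogeneousSubmodule σ k)).toIdeal) l := by
  refine (isSMulRegular_quotient_iff_mem_of_smul_mem _ l).2 fun G hG => ?_
  refine mem_homogeneousCore_iff.2 fun t => ?_
  have hlG := mem_homogeneousCore_iff.1 hG (1 + t)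
  rw [smul_eq_mul, homogeneousComponent_linear_form_mul hl] at hlG
  have h := P.sub_mem hlG (P.mul_mem_right (homogeneousComponent t G) hlP)
  rwa [← sub_mul, sub_sub_cancel, one_mul] at h

theorem le_homogeneousCore_sup_span_sub_one (hl : l.IsHomogeneous 1) (hlP : l - 1 ∈ P) :
    P ≤ (P.homogeneousCore (homogeneousSubmodule σ k)).toIdeal ⊔ Ideal.span {l - 1} := by
  intro G hG
  have hsub := sub_homogenize_mem_span l (le_refl G.totalDegree)
  have hmem : homogenize l G.totalDegree G ∈ P := by
    have h := P.sub_mem hG ((Ideal.span_singleton_le_iff_mem P).2 hlP hsub)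
    rwa [sub_sub_cancel] at h
  rw [← add_sub_cancel (homogenize l G.totalDegree G) G]
  exact Submodule.add_mem_sup (Ideal.mem_homogeneousCore_of_homogeneous_of_mem
    ⟨_, isHomogeneous_homogenize hl _ G⟩ hmem) hsub

end HomogeneousCore

theorem le_ker_constantCoeff_of_isHomogeneous {σ k : Type*} [Field k]
    {I : Ideal (MvPolynomial σ k)} (hI : I.IsHomogeneous (homogeneousSubmodule σ k))
    (hne : I ≠ ⊤) : I ≤ RingHom.ker (constantCoeff : MvPolynomial σ k →+* k) := by
  intro G hG
  by_contra h
  have hC := homogeneousComponent_mem_of_mem hI hG 0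
  rw [homogeneousComponent_zero] at hC
  exact hne (Ideal.eq_top_of_isUnit_mem I hC ((isUnit_iff_ne_zero.2 h).map C))

theorem one_le_ringKrullDim_quotient {σ k : Type*} [Field k] {I : Ideal (MvPolynomial σ k)}
    (hI : I.IsHomogeneous (homogeneousSubmodule σ k)) (hne : I ≠ ⊤) {l : MvPolynomial σ k}
    (hl : l.IsHomogeneous 1) (hreg : IsSMulRegular (MvPolynomial σ k ⧸ I) l) :
    1 ≤ ringKrullDim (MvPolynomial σ k ⧸ I) := by
  let ε : MvPolynomial σ k ⧸ I →+* k :=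
    Ideal.Quotient.lift I constantCoeff fun _ hG => le_ker_constantCoeff_of_isHomogeneous hI hne hG
  have hε : Function.Surjective ε := fun c => ⟨Ideal.Quotient.mk I (C c), constantCoeff_C _ c⟩
  have hl0 : ε (Ideal.Quotient.mk I l) = 0 := hl.coeff_eq_zero (by simp)
  have hnzd : Ideal.Quotient.mk I l ∈ nonZeroDivisors (MvPolynomial σ k ⧸ I) := by
    refine mem_nonZeroDivisors_iff_right.2 fun x hx => ?_
    obtain ⟨G, rfl⟩ := Ideal.Quotient.mk_surjective x
    rw [← map_mul, mul_comm, Ideal.Quotient.eq_zero_iff_mem] at hx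
    exact Ideal.Quotient.eq_zero_iff_mem.2 (mem_of_isSMulRegular_quotient_of_smul_mem hreg hx)
  simpa using ringKrullDim_succ_le_of_surjective ε hε hnzd hl0

section Action

variable {k : Type*} [Field k] {n : ℕ}

theorem diffAction_monomial_eq_zero {α β : Fin (n + 1) →₀ ℕ} (h : ¬ β ≤ α) (a b : k) :
    diffAction k n (monomial β a) (monomial α b) = 0 := by
  obtain ⟨i, hi⟩ : ∃ i, α i < β i := by
    by_contra! h'
    exact h h'
  rw [diffAction_monomial, Finset.prod_eq_zero (Finset.mem_univ i), mul_zero, monomial_zero]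
  rw [Nat.descFactorial_eq_zero_iff_lt.2 hi, Nat.cast_zero]

theorem diffAction_eq_sum (G : PolyR k n) (F : PolyS k n) :
    diffAction k n G F = ∑ β ∈ G.support, ∑ α ∈ F.support,
      diffAction k n (monomial β (coeff β G)) (monomial α (coeff α F)) := by
  conv_lhs => rw [← support_sum_monomial_coeff G, ← support_sum_monomial_coeff F]
  simp only [map_sum, LinearMap.sum_apply]
  exact Finset.sum_comm

variable {G : PolyR k n} {F : PolyS k n} {i j : ℕ}

theorem isHomogeneous_diffAction (hG : G.IsHomogeneous i) (hF : F.IsHomogeneous j) :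
    (diffAction k n G F).IsHomogeneous (j - i) := by
  rw [diffAction_eq_sum]
  refine IsHomogeneous.sum _ _ _ fun β hβ => IsHomogeneous.sum _ _ _ fun α hα => ?_
  by_cases h : β ≤ α
  · rw [diffAction_monomial]
    apply isHomogeneous_monomial
    have hadd := congrArg Finsupp.degree (tsub_add_cancel_of_le h)
    have hα' : j = α.degree := hF.degree_eq_sum_deg_support hα
    have hβ' : i = β.degree := hG.degree_eq_sum_deg_support hβ
    rw [map_add] at hadd
    omega
  · rw [diffAction_monomial_eq_zero h]
    exact isHomogeneous_zero _ _ _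

theorem diffAction_eq_zero_of_lt (hG : G.IsHomogeneous i) (hF : F.IsHomogeneous j) (hij : j < i) :
    diffAction k n G F = 0 := by
  rw [diffAction_eq_sum]
  refine Finset.sum_eq_zero fun β hβ => Finset.sum_eq_zero fun α hα => ?_
  refine diffAction_monomial_eq_zero (fun h => hij.not_ge ?_) _ _
  rw [hG.degree_eq_sum_deg_support hβ, hF.degree_eq_sum_deg_support hα]
  exact Finsupp.degree_mono h

/-- The linear form `G ↦ (G ∘ F)(0)` on `R`. On forms of degree `d`, for `F` homogeneous of degree
`d`, it is the constant `G ∘ F` itself. -/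
noncomputable def apolarityFunctional (F : PolyS k n) : PolyR k n →ₗ[k] k :=
  lcoeff k 0 ∘ₗ (diffAction k n).flip F

theorem apolarityFunctional_apply (F : PolyS k n) (G : PolyR k n) :
    apolarityFunctional F G = coeff 0 (diffAction k n G F) := rfl

theorem apolarityFunctional_monomial_one (F : PolyS k n) (β : Fin (n + 1) →₀ ℕ) :
    apolarityFunctional F (monomial β 1) = (∏ i, ((β i).factorial : k)) * coeff β F := by
  rw [apolarityFunctional_apply]
  induction F using MvPolynomial.induction_on' with
  | add p q hp hq => rw [map_add, coeff_add, coeff_add, hp, hq, mul_add]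
  | monomial α c =>
    rcases eq_or_ne α β with rfl | hne
    · rw [diffAction_monomial, tsub_self, one_mul, coeff_monomial, if_pos rfl, coeff_monomial,
        if_pos rfl, mul_comm]
      simp only [Nat.descFactorial_self]
    rw [coeff_monomial, if_neg hne, mul_zero]
    by_cases h : β ≤ α
    · rw [diffAction_monomial, coeff_monomial, if_neg]
      exact fun hsub => hne (le_antisymm (tsub_eq_zero_iff_le.1 hsub) h)
    · rw [diffAction_monomial_eq_zero h, coeff_zero]

theorem eq_zero_of_forall_apolarityFunctional_eq_zero (hF : F.IsHomogeneous i)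
    (hi : (i.factorial : k) ≠ 0) (h : ∀ G, G.IsHomogeneous i → apolarityFunctional F G = 0) :
    F = 0 := by
  ext β
  rw [coeff_zero]
  by_cases hβ : β.degree = i
  · have hdvd : ∏ t, (β t).factorial ∣ i.factorial := by
      rw [← hβ, Finsupp.degree_eq_sum]
      exact Nat.prod_factorial_dvd_factorial_sum _ _
    have hne : (∏ t, ((β t).factorial : k)) ≠ 0 := by
      rw [← Nat.cast_prod]
      exact ne_zero_of_dvd_ne_zero hi (Nat.cast_dvd_cast hdvd)
    have hzero := h _ (isHomogeneous_monomial 1 hβ)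
    rw [apolarityFunctional_monomial_one] at hzero
    exact (mul_eq_zero.1 hzero).resolve_left hne
  · exact hF.coeff_eq_zero hβ

theorem le_ann_of_forall_apolarityFunctional_eq_zero {I : Ideal (PolyR k n)}
    (hI : I.IsHomogeneous (homogeneousSubmodule (Fin (n + 1)) k)) {d : ℕ} (hF : F.IsHomogeneous d)
    (hd : (d.factorial : k) ≠ 0)
    (h : ∀ G ∈ I, G.IsHomogeneous d → apolarityFunctional F G = 0) : I ≤ ann F := by
  intro G hG
  rw [← sum_homogeneousComponent G]
  refine Ideal.sum_mem _ fun t _ => ?_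
  have hGt := homogeneousComponent_isHomogeneous t G
  have hGI := homogeneousComponent_mem_of_mem hI hG t
  change diffAction k n _ F = 0
  rcases lt_or_ge d t with hdt | htd
  · exact diffAction_eq_zero_of_lt hGt hF hdt
  have hfac : ((d - t).factorial : k) ≠ 0 :=
    ne_zero_of_dvd_ne_zero hd (Nat.cast_dvd_cast (Nat.factorial_dvd_factorial (d.sub_le t)))
  refine eq_zero_of_forall_apolarityFunctional_eq_zero (isHomogeneous_diffAction hGt hF) hfac
    fun H hH => ?_
  rw [apolarityFunctional_apply, ← diffAction_mul]
  refine h _ (I.mul_mem_left _ hGI) ?_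
  have hHG := hH.mul hGt
  rwa [Nat.sub_add_cancel htd] at hHG

end Action

namespace ZeroDimScheme

variable {k : Type*} [Field k] {n : ℕ} {Z : ZeroDimScheme k n} {l : PolyR k n}

theorem sub_one_mem_comap_chartMap (K : Ideal (chartRing Z.ideal l)) :
    l - 1 ∈ K.comap (chartMap Z.ideal l) := by
  rw [Ideal.mem_comap, map_sub, map_one, chartMap_self, sub_self]
  exact K.zero_mem

theorem ideal_le_homogeneousCore_comap_chartMap (K : Ideal (chartRing Z.ideal l)) :
    Z.ideal ≤ ((K.comap (chartMap Z.ideal l)).homogeneousCore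
      (homogeneousSubmodule (Fin (n + 1)) k)).toIdeal := by
  refine Z.homogeneous.toIdeal_homogeneousCore_eq_self.ge.trans
    (Ideal.homogeneousCore_mono _ fun G hG => ?_)
  rw [Ideal.mem_comap, (chartMap_eq_zero_iff Z.ideal).2 (Ideal.mem_sup_left hG)]
  exact K.zero_mem

/-- The closure in `ℙⁿ` of the nonempty closed subscheme of the chart `l ≠ 0` of `Z` which is
defined by an ideal `K`: its homogeneous ideal is generated by the forms restricting into `K`. -/
noncomputable def chartClosure (hl : l.IsHomogeneous 1) (K : Ideal (chartRing Z.ideal l))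
    (hK : K ≠ ⊤) : ZeroDimScheme k n where
  ideal := ((K.comap (chartMap Z.ideal l)).homogeneousCore
    (homogeneousSubmodule (Fin (n + 1)) k)).toIdeal
  homogeneous := HomogeneousIdeal.isHomogeneous _
  saturated _ hG := mem_of_isSMulRegular_quotient_of_smul_mem
    (isSMulRegular_quotient_homogeneousCore hl (sub_one_mem_comap_chartMap K))
    (linear_form_mul_mem hl hG)
  dim_eq_zero := by
    refine le_antisymm ?_ (one_le_ringKrullDim_quotient (HomogeneousIdeal.isHomogeneous _) ?_ hl
      (isSMulRegular_quotient_homogeneousCore hl (sub_one_mem_comap_chartMap K)))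
    · rw [← Z.dim_eq_zero]
      exact ringKrullDim_le_of_surjective _
        (Ideal.Quotient.factor_surjective (ideal_le_homogeneousCore_comap_chartMap K))
    · intro htop
      have hcomap := top_le_iff.1 (htop ▸ Ideal.toIdeal_homogeneousCore_le _ _)
      exact hK ((Ideal.comap_eq_top_iff).1 hcomap)

variable {hl : l.IsHomogeneous 1} {K : Ideal (chartRing Z.ideal l)} {hK : K ≠ ⊤}

theorem ideal_le_chartClosure_ideal : Z.ideal ≤ (chartClosure hl K hK).ideal :=
  ideal_le_homogeneousCore_comap_chartMap K

theorem chartMap_mem_of_mem_chartClosure_ideal {G : PolyR k n}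
    (hG : G ∈ (chartClosure hl K hK).ideal) : chartMap Z.ideal l G ∈ K :=
  Ideal.mem_comap.1 (Ideal.toIdeal_homogeneousCore_le _ _ hG)

theorem eq_bot_of_chartClosure_ideal_eq (h : (chartClosure hl K hK).ideal = Z.ideal) : K = ⊥ := by
  have hle := le_homogeneousCore_sup_span_sub_one hl (sub_one_mem_comap_chartMap K)
  change _ ≤ (chartClosure hl K hK).ideal ⊔ _ at hle
  rw [h] at hle
  refine eq_bot_iff.2 fun x hx => ?_
  obtain ⟨G, rfl⟩ := chartMap_surjective Z.ideal l x
  exact (chartMap_eq_zero_iff Z.ideal).2 (hle hx)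

theorem IsIrredundant.eq_bot_of_le_ker {F : PolyS k n} (hirr : Z.IsIrredundant F) {d : ℕ}
    (hF : F.IsHomogeneous d) (hd : (d.factorial : k) ≠ 0) (hl : l.IsHomogeneous 1)
    {φ : chartRing Z.ideal l →ₗ[k] k}
    (hφ : ∀ G, G.IsHomogeneous d → φ (chartMap Z.ideal l G) = apolarityFunctional F G)
    (hK : K ≠ ⊤) (hKφ : K.restrictScalars k ≤ LinearMap.ker φ) : K = ⊥ := by
  by_contra hne
  refine hirr.2 ⟨chartClosure hl K hK, ideal_le_chartClosure_ideal.lt_of_ne fun h =>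
    hne (eq_bot_of_chartClosure_ideal_eq h.symm), ?_⟩
  exact le_ann_of_forall_apolarityFunctional_eq_zero (chartClosure hl K hK).homogeneous hF hd
    fun G hG hGd => (hφ G hGd).symm.trans (hKφ (chartMap_mem_of_mem_chartClosure_ideal hG))

theorem IsApolar.exists_functional {F : PolyS k n} (hZ : Z.IsApolar F) (hl : l.IsHomogeneous 1)
    (hreg : IsSMulRegular (PolyR k n ⧸ Z.ideal) l) (d : ℕ) :
    ∃ f : chartRing Z.ideal l →ₗ[k] k, ∀ G, G.IsHomogeneous d →
      f (chartMap Z.ideal l G) = apolarityFunctional F G := by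
  have hmem : apolarityFunctional F ∘ₗ Submodule.subtype _ ∈
      LinearMap.range (Z.chartMapOnForms l d).dualMap := by
    rw [LinearMap.range_dualMap_eq_dualAnnihilator_ker, ker_chartMapOnForms hl hreg,
      Submodule.mem_dualAnnihilator]
    intro G hG
    have hGF : diffAction k n (G : PolyR k n) F = 0 := hZ hG
    rw [LinearMap.comp_apply, Submodule.subtype_apply, apolarityFunctional_apply, hGF, coeff_zero]
  obtain ⟨f, hf⟩ := hmem
  exact ⟨f, fun G hG => LinearMap.congr_fun hf ⟨G, hG⟩⟩

end ZeroDimScheme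

section Saturation

variable {σ k : Type*} [CommRing k] {I : Ideal (MvPolynomial σ k)}

theorem mem_of_span_X_pow_le_colon (hI : ∀ G, (∀ i, X i * G ∈ I) → G ∈ I) {t : ℕ}
    {G : MvPolynomial σ k} (hG : Ideal.span (Set.range X) ^ t ≤ I.colon {G}) : G ∈ I := by
  induction t generalizing G with
  | zero => simpa using hG (show (1 : MvPolynomial σ k) ∈ _ by simp)
  | succ t ih =>
    refine ih fun u hu => Submodule.mem_colon_singleton.2 (hI _ fun i => ?_)
    rw [smul_eq_mul, ← mul_assoc]
    refine Submodule.mem_colon_singleton.1 (hG ?_)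
    rw [pow_succ']
    exact Ideal.mul_mem_mul (Ideal.subset_span ⟨i, rfl⟩) hu

theorem isSMulRegular_quotient_of_span_X_pow_le (hI : ∀ G, (∀ i, X i * G ∈ I) → G ∈ I)
    {l : MvPolynomial σ k} {t : ℕ} (hl : Ideal.span (Set.range X) ^ t ≤ Ideal.span {l} ⊔ I) :
    IsSMulRegular (MvPolynomial σ k ⧸ I) l := by
  refine (isSMulRegular_quotient_iff_mem_of_smul_mem I l).2 fun G hG =>
    mem_of_span_X_pow_le_colon hI (hl.trans (sup_le ?_ fun u hu => ?_))
  · rwa [Ideal.span_singleton_le_iff_mem, Submodule.mem_colon_singleton]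
  · exact Submodule.mem_colon_singleton.2 (I.mul_mem_right G hu)

end Saturation

section IndependentPoints

variable {k : Type*} [Field k] {n : ℕ} {ι : Type*}

theorem diffAction_X_X (i j : Fin (n + 1)) :
    diffAction k n (X i) (X j) = if i = j then 1 else 0 := by
  split_ifs with hij
  · subst hij
    rw [X, diffAction_monomial, tsub_self, Finset.prod_eq_one, mul_one, mul_one, ← C_apply, C_1]
    intro t _
    by_cases ht : i = t
    · simp [ht]
    · simp [ht]
  · refine diffAction_monomial_eq_zero (fun h => ?_) _ _
    have hi := h i
    simp [Ne.symm hij] at hi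

theorem diffAction_sum_smul_X (f : PolyS k n →ₗ[k] k) {L : PolyS k n} (hL : L.IsHomogeneous 1) :
    diffAction k n (∑ i, f (X i) • X i) L = C (f L) := by
  rw [← mem_homogeneousSubmodule, homogeneousSubmodule_one_eq_span_X] at hL
  induction hL using Submodule.span_induction with
  | zero => simp
  | add L M _ _ hL hM => rw [map_add, map_add, C_add, hL, hM]
  | smul a L _ hL => rw [map_smul, map_smul, hL, smul_eq_mul, C_mul, smul_eq_C_mul]
  | mem _ h =>
    obtain ⟨j, rfl⟩ := h
    rw [map_sum, LinearMap.sum_apply, Finset.sum_eq_single_of_mem j (Finset.mem_univ j), map_smul,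
      LinearMap.smul_apply, diffAction_X_X, if_pos rfl, smul_eq_C_mul, mul_one]
    intro i _ hij
    rw [map_smul, LinearMap.smul_apply, diffAction_X_X, if_neg hij, smul_zero]

theorem exists_diffAction_eq_C {w : PolyR k n} (hw : w.IsHomogeneous 1) {L : PolyS k n}
    (hL : L.IsHomogeneous 1) : ∃ c : k, diffAction k n w L = C c := by
  have h := isHomogeneous_diffAction hw hL
  rw [Nat.sub_self, ← totalDegree_zero_iff_isHomogeneous, totalDegree_eq_zero_iff_eq_C] at h
  exact ⟨_, h⟩

/-- Linear forms `y i` of `R` are dual to linear forms `L j` of `S` if `y i ∘ L j` is the Kronecker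
delta: `y i` is a homogeneous coordinate which is nonzero at the point `[L i]` and vanishes at the
other points `[L j]`. -/
structure IsDualFamily (y : ι → PolyR k n) (L : ι → PolyS k n) : Prop where
  isHomogeneous : ∀ i, (y i).IsHomogeneous 1
  diffAction_self : ∀ i, diffAction k n (y i) (L i) = 1
  diffAction_of_ne : ∀ i j, i ≠ j → diffAction k n (y i) (L j) = 0

theorem exists_isDualFamily {L : ι → PolyS k n} (hL : ∀ i, (L i).IsHomogeneous 1)
    (hLind : LinearIndependent k L) : ∃ y : ι → PolyR k n, IsDualFamily y L := by
  obtain ⟨g, hg⟩ := (Finsupp.linearCombination k L).exists_leftInverse_of_injective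
    (LinearMap.ker_eq_bot.2 hLind)
  have hgL (j : ι) : g (L j) = Finsupp.single j 1 := by
    simpa using LinearMap.congr_fun hg (Finsupp.single j 1)
  let y (i : ι) : PolyR k n := ∑ t, (Finsupp.lapply i ∘ₗ g) (X t) • X t
  have hyL (i j : ι) : diffAction k n (y i) (L j) = C (Finsupp.single j 1 i) := by
    rw [diffAction_sum_smul_X _ (hL j), LinearMap.comp_apply, hgL, Finsupp.lapply_apply]
  refine ⟨y, fun i => ?_, fun i => ?_, fun i j hij => ?_⟩
  · exact IsHomogeneous.sum _ _ _ fun t _ => (homogeneousSubmodule _ k 1).smul_mem _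
      (isHomogeneous_X k t)
  · rw [hyL, Finsupp.single_eq_same, C_1]
  · rw [hyL, Finsupp.single_eq_of_ne hij, C_0]

/-- Generators of the ideal of the reduced scheme `{[L j]}`, for a family `y` dual to `L`: the
linear forms vanishing at all these points, and the products `y i * y j` with `i ≠ j`. -/
def reducedPointsGenerators (y : ι → PolyR k n) (L : ι → PolyS k n) : Set (PolyR k n) :=
  {w | w.IsHomogeneous 1 ∧ ∀ j, diffAction k n w (L j) = 0} ∪
    {g | ∃ i j, i ≠ j ∧ y i * y j = g}

namespace IsDualFamily

variable {y : ι → PolyR k n} {L : ι → PolyS k n}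

theorem span_generators_le_pointIdeal (hy : IsDualFamily y L) (j : ι) :
    Ideal.span (reducedPointsGenerators y L) ≤ pointIdeal (L j) := by
  have hyj (i : ι) (hij : i ≠ j) : y i ∈ pointIdeal (L j) :=
    Ideal.subset_span ⟨hy.isHomogeneous i, hy.diffAction_of_ne i j hij⟩
  rw [Ideal.span_le]
  rintro _ (⟨hw, hwL⟩ | ⟨i, i', hne, rfl⟩)
  · exact Ideal.subset_span ⟨hw, hwL j⟩
  · rcases eq_or_ne i j with rfl | hij
    · exact Ideal.mul_mem_left _ _ (hyj i' hne.symm)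
    · exact Ideal.mul_mem_right _ _ (hyj i hij)

theorem totalDegree_le_two (hy : IsDualFamily y L) :
    ∀ w ∈ reducedPointsGenerators y L, w.totalDegree ≤ 2 := by
  rintro _ (⟨hw, -⟩ | ⟨i, j, -, rfl⟩)
  · exact hw.totalDegree_le.trans one_le_two
  · exact ((hy.isHomogeneous i).mul (hy.isHomogeneous j)).totalDegree_le

theorem isHomogeneous_sum [Fintype ι] (hy : IsDualFamily y L) : (∑ i, y i).IsHomogeneous 1 :=
  IsHomogeneous.sum _ _ _ fun i _ => hy.isHomogeneous i

theorem exists_sub_sum_mem_generators [Fintype ι] (hy : IsDualFamily y L)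
    (hL : ∀ i, (L i).IsHomogeneous 1) {w : PolyR k n} (hw : w.IsHomogeneous 1) :
    ∃ c : ι → k, w - ∑ i, c i • y i ∈ reducedPointsGenerators y L := by
  choose c hc using fun j => exists_diffAction_eq_C hw (hL j)
  refine ⟨c, Or.inl ⟨?_, fun j => ?_⟩⟩
  · exact hw.sub (IsHomogeneous.sum _ _ _ fun i _ =>
      (homogeneousSubmodule _ k 1).smul_mem _ (hy.isHomogeneous i))
  · rw [map_sub, LinearMap.sub_apply, hc, map_sum, LinearMap.sum_apply,
      Finset.sum_eq_single_of_mem j (Finset.mem_univ j), map_smul, LinearMap.smul_apply,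
      hy.diffAction_self, smul_eq_C_mul, mul_one, sub_self]
    intro i _ hij
    rw [map_smul, LinearMap.smul_apply, hy.diffAction_of_ne i j hij, smul_zero]

theorem span_X_le [Finite ι] (hy : IsDualFamily y L) (hL : ∀ i, (L i).IsHomogeneous 1) :
    Ideal.span (Set.range X) ≤
      Ideal.span (Set.range y) ⊔ Ideal.span (reducedPointsGenerators y L) := by
  cases nonempty_fintype ι
  rw [Ideal.span_le]
  rintro _ ⟨t, rfl⟩
  obtain ⟨c, hc⟩ := hy.exists_sub_sum_mem_generators hL (isHomogeneous_X k t)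
  rw [SetLike.mem_coe, ← add_sub_cancel (∑ i, c i • y i) (X t)]
  exact Submodule.add_mem_sup (Ideal.sum_mem _ fun i _ => Submodule.smul_of_tower_mem _ _
    (Ideal.subset_span ⟨i, rfl⟩)) (Ideal.subset_span hc)

end IsDualFamily

theorem mul_mem_span_sum_sup [Fintype ι] (y : ι → PolyR k n) (L : ι → PolyS k n) (i j : ι) :
    y i * y j ∈ Ideal.span {∑ i, y i} ⊔ Ideal.span (reducedPointsGenerators y L) := by
  classical
  have hne (i j : ι) (hij : i ≠ j) : y i * y j ∈ Ideal.span (reducedPointsGenerators y L) :=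
    Ideal.subset_span (Or.inr ⟨i, j, hij, rfl⟩)
  rcases eq_or_ne i j with rfl | hij
  · have hsq : y i * y i = y i * ∑ j, y j - ∑ j ∈ Finset.univ.erase i, y i * y j := by
      rw [Finset.mul_sum, ← Finset.add_sum_erase _ _ (Finset.mem_univ i), add_sub_cancel_right]
    rw [hsq]
    exact Ideal.sub_mem _
      (Ideal.mem_sup_left (Ideal.mul_mem_left _ _ (Ideal.mem_span_singleton_self _)))
      (Ideal.mem_sup_right (Ideal.sum_mem _ fun j hj => hne i j (Finset.ne_of_mem_erase hj).symm))
  · exact Ideal.mem_sup_right (hne i j hij)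

theorem completeOrthogonalIdempotents_map [Fintype ι] {y : ι → PolyR k n} {L : ι → PolyS k n}
    {B : Type*} [CommRing B] [Algebra k B] {g : PolyR k n →ₐ[k] B} (hgsum : g (∑ i, y i) = 1)
    (hg : ∀ w ∈ reducedPointsGenerators y L, g w = 0) :
    CompleteOrthogonalIdempotents fun i => g (y i) := by
  rw [CompleteOrthogonalIdempotents.iff_ortho_complete]
  refine ⟨fun i j hij => ?_, by rw [← map_sum, hgsum]⟩
  change g (y i) * g (y j) = 0
  rw [← map_mul]
  exact hg _ (Or.inr ⟨i, j, hij, rfl⟩)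

namespace IsDualFamily

variable {y : ι → PolyR k n} {L : ι → PolyS k n} [Fintype ι]

theorem span_X_sq_le (hy : IsDualFamily y L) (hL : ∀ i, (L i).IsHomogeneous 1) :
    Ideal.span (Set.range X) ^ 2 ≤
      Ideal.span {∑ i, y i} ⊔ Ideal.span (reducedPointsGenerators y L) := by
  refine (Ideal.pow_right_mono (hy.span_X_le hL) 2).trans ?_
  rw [pow_two, Ideal.sup_mul]
  refine sup_le ?_ (le_sup_of_le_right Ideal.mul_le_left)
  rw [Ideal.mul_sup]
  refine sup_le ?_ (le_sup_of_le_right Ideal.mul_le_right)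
  rw [Ideal.span_mul_span', Ideal.span_le]
  rintro _ ⟨_, ⟨i, rfl⟩, _, ⟨j, rfl⟩, rfl⟩
  exact mul_mem_span_sum_sup y L i j

theorem isSMulRegular_sum (hy : IsDualFamily y L) (hL : ∀ i, (L i).IsHomogeneous 1)
    {I : Ideal (PolyR k n)} (hI : ∀ G, (∀ i, X i * G ∈ I) → G ∈ I) {m : ℕ}
    (hm : Ideal.span (reducedPointsGenerators y L) ^ m ≤ I) :
    IsSMulRegular (PolyR k n ⧸ I) (∑ i, y i) := by
  refine isSMulRegular_quotient_of_span_X_pow_le hI (t := 2 * (1 + m)) ?_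
  calc Ideal.span (Set.range X) ^ (2 * (1 + m))
      ≤ (Ideal.span {∑ i, y i} ⊔ Ideal.span (reducedPointsGenerators y L)) ^ (1 + m) := by
        rw [pow_mul]
        exact Ideal.pow_right_mono (hy.span_X_sq_le hL) _
    _ ≤ Ideal.span {∑ i, y i} ^ 1 ⊔ Ideal.span (reducedPointsGenerators y L) ^ m :=
        Ideal.sup_pow_add_le_pow_sup_pow
    _ ≤ Ideal.span {∑ i, y i} ⊔ I := by
        rw [pow_one]
        exact sup_le_sup_left hm _

theorem span_range_map_eq_top (hy : IsDualFamily y L) (hL : ∀ i, (L i).IsHomogeneous 1)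
    {B : Type*} [CommRing B] [Algebra k B] {g : PolyR k n →ₐ[k] B} (hgsurj : Function.Surjective g)
    (hgsum : g (∑ i, y i) = 1) (hg : ∀ w ∈ reducedPointsGenerators y L, g w = 0) :
    Submodule.span k (Set.range fun i => g (y i)) = ⊤ := by
  refine span_range_eq_top_of_le (completeOrthogonalIdempotents_map hgsum hg)
    (s := g '' Set.range X) ?_ ?_
  · rw [← AlgHom.map_adjoin, adjoin_range_X, Algebra.map_top, AlgHom.range_eq_top]
    exact hgsurj
  · rintro _ ⟨_, ⟨t, rfl⟩, rfl⟩
    obtain ⟨c, hc⟩ := hy.exists_sub_sum_mem_generators hL (isHomogeneous_X k t)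
    have hgX := hg _ hc
    rw [map_sub, sub_eq_zero, map_sum] at hgX
    rw [hgX]
    refine sum_mem fun i _ => ?_
    rw [map_smul]
    exact Submodule.smul_mem _ _ (Submodule.subset_span ⟨i, rfl⟩)

end IsDualFamily

end IndependentPoints

section ReducedPointsInChart

variable {k : Type*} [Field k] {n : ℕ} {ι : Type*} {y : ι → PolyR k n} {L : ι → PolyS k n}
  {A : Type*} [CommRing A] [Algebra k A]

/-- The image, under `h : R → A`, of the ideal of the reduced scheme `{[L j]}`, for a family `y`
dual to `L`. If `A` is the coordinate ring of the chart `∑ i, y i ≠ 0` of a scheme, this is the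
ideal of the part of `{[L j]}` contained in that scheme. -/
noncomputable def reducedPointsIdeal (h : PolyR k n →ₐ[k] A) (y : ι → PolyR k n)
    (L : ι → PolyS k n) : Ideal A :=
  (Ideal.span (reducedPointsGenerators y L)).map h

variable {h : PolyR k n →ₐ[k] A}

theorem mk_reducedPointsIdeal_comp_eq_zero {w : PolyR k n} (hw : w ∈ reducedPointsGenerators y L) :
    (Ideal.Quotient.mkₐ k (reducedPointsIdeal h y L)).comp h w = 0 :=
  Ideal.Quotient.eq_zero_iff_mem.2 (Ideal.mem_map_of_mem h (Ideal.subset_span hw))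

theorem reducedPointsIdeal_pow_eq_bot {I : Ideal (PolyR k n)} {l : PolyR k n} {q : ℕ}
    (hI : Ideal.span (reducedPointsGenerators y L) ^ q ≤ I) :
    reducedPointsIdeal (chartMap I l) y L ^ q = ⊥ := by
  rw [reducedPointsIdeal, ← Ideal.map_pow, Ideal.map_eq_bot_iff_le_ker]
  exact fun G hG => (chartMap_eq_zero_iff I).2 (Ideal.mem_sup_left (hI hG))

namespace IsDualFamily

variable [Fintype ι]

theorem span_range_mk_map_eq_top (hy : IsDualFamily y L) (hL : ∀ i, (L i).IsHomogeneous 1)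
    (hsurj : Function.Surjective h) (hsum : h (∑ i, y i) = 1) :
    Submodule.span k (Set.range fun i =>
      (Ideal.Quotient.mkₐ k (reducedPointsIdeal h y L)).comp h (y i)) = ⊤ := by
  refine hy.span_range_map_eq_top hL ((Ideal.Quotient.mkₐ_surjective k _).comp hsurj) ?_
    fun _ => mk_reducedPointsIdeal_comp_eq_zero
  rw [AlgHom.comp_apply, hsum, map_one]

theorem mem_reducedPointsIdeal (hy : IsDualFamily y L) (hL : ∀ i, (L i).IsHomogeneous 1)
    (hsurj : Function.Surjective h) (hsum : h (∑ i, y i) = 1) {a : A}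
    (ha : ∀ c : k, IsUnit (1 + c • a)) : a ∈ reducedPointsIdeal h y L := by
  have he : CompleteOrthogonalIdempotents fun i =>
      (Ideal.Quotient.mkₐ k (reducedPointsIdeal h y L)).comp h (y i) :=
    completeOrthogonalIdempotents_map (by rw [AlgHom.comp_apply, hsum, map_one])
      fun _ => mk_reducedPointsIdeal_comp_eq_zero
  refine Ideal.Quotient.eq_zero_iff_mem.1 (eq_zero_of_forall_isUnit_one_add_smul
    (k := k) he.toOrthogonalIdempotents (hy.span_range_mk_map_eq_top hL hsurj hsum) fun c => ?_)
  exact (ha c).map (Ideal.Quotient.mkₐ k (reducedPointsIdeal h y L))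

theorem exists_sub_sum_mem_reducedPointsIdeal (hy : IsDualFamily y L)
    (hL : ∀ i, (L i).IsHomogeneous 1) (hsurj : Function.Surjective h)
    (hsum : h (∑ i, y i) = 1) (x : A) :
    ∃ c : ι → k, x - ∑ i, c i • h (y i) ∈ reducedPointsIdeal h y L := by
  obtain ⟨c, hc⟩ := (Submodule.mem_span_range_iff_exists_fun k).1
    (hy.span_range_mk_map_eq_top hL hsurj hsum ▸
      Submodule.mem_top (x := Ideal.Quotient.mkₐ k (reducedPointsIdeal h y L) x))
  refine ⟨c, (Ideal.Quotient.mk_eq_mk_iff_sub_mem _ _).1 (hc.symm.trans ?_)⟩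
  change _ = Ideal.Quotient.mkₐ k _ _
  simp only [map_sum, map_smul, AlgHom.comp_apply]

theorem formsInChart_one_sup_reducedPointsIdeal (hy : IsDualFamily y L)
    (hL : ∀ i, (L i).IsHomogeneous 1) (I : Ideal (PolyR k n)) :
    formsInChart I (∑ i, y i) 1 ⊔
      (reducedPointsIdeal (chartMap I (∑ i, y i)) y L).restrictScalars k = ⊤ := by
  refine eq_top_iff.2 fun x _ => ?_
  obtain ⟨c, hc⟩ := hy.exists_sub_sum_mem_reducedPointsIdeal hL (chartMap_surjective I _)
    (chartMap_self I _) x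
  rw [← add_sub_cancel (∑ i, c i • chartMap I (∑ i, y i) (y i)) x]
  exact Submodule.add_mem_sup (sum_mem fun i _ => Submodule.smul_mem _ _
    (chartMap_mem_formsInChart I hy.isHomogeneous_sum (hy.isHomogeneous i).totalDegree_le)) hc

theorem formsInChart_sup_reducedPointsIdeal_pow (hy : IsDualFamily y L)
    (hL : ∀ i, (L i).IsHomogeneous 1) (I : Ideal (PolyR k n)) {e q : ℕ} (hqe : 2 * q ≤ e + 1) :
    formsInChart I (∑ i, y i) e ⊔
      (reducedPointsIdeal (chartMap I (∑ i, y i)) y L ^ q).restrictScalars k = ⊤ :=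
  formsInChart_sup_map_pow_eq_top I hy.isHomogeneous_sum hy.totalDegree_le_two
    (hy.formsInChart_one_sup_reducedPointsIdeal hL I) hqe

theorem finiteDimensional_chartRing {I : Ideal (PolyR k n)} (hy : IsDualFamily y L)
    (hL : ∀ i, (L i).IsHomogeneous 1) {q : ℕ}
    (hI : Ideal.span (reducedPointsGenerators y L) ^ q ≤ I) :
    FiniteDimensional k (chartRing I (∑ i, y i)) := by
  have htop := hy.formsInChart_sup_reducedPointsIdeal_pow hL I (Nat.le_succ (2 * q))
  rw [reducedPointsIdeal_pow_eq_bot hI, Submodule.restrictScalars_bot, sup_bot_eq] at htop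
  exact Module.finite_def.2 (htop ▸ Module.Finite.iff_fg.1 (finite_formsInChart I _ _))

theorem formsInChart_eq_top_of_isIrredundant (hy : IsDualFamily y L)
    (hL : ∀ i, (L i).IsHomogeneous 1) {Z : ZeroDimScheme k n} {m d : ℕ}
    (hZ : Ideal.span (reducedPointsGenerators y L) ^ (m + 1) ≤ Z.ideal) (hm : 2 * m ≤ d + 1)
    {F : PolyS k n} (hF : F.IsHomogeneous d) (hd : (d.factorial : k) ≠ 0)
    (hirr : Z.IsIrredundant F) : formsInChart Z.ideal (∑ i, y i) d = ⊤ := by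
  have hl := hy.isHomogeneous_sum
  have hfin := hy.finiteDimensional_chartRing hL hZ
  obtain ⟨f, hf⟩ := hirr.1.exists_functional hl (hy.isSMulRegular_sum hL Z.saturated hZ) d
  refine eq_top_of_forall_extension (reducedPointsIdeal_pow_eq_bot hZ)
    (fun _ => hy.mem_reducedPointsIdeal hL (chartMap_surjective _ _) (chartMap_self _ _))
    (one_mem_formsInChart Z.ideal hl d)
    (hy.formsInChart_sup_reducedPointsIdeal_pow hL Z.ideal hm) f fun φ hφ K hK hKφ => ?_
  exact hirr.eq_bot_of_le_ker hF hd hl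
    (fun G hG => (hφ ⟨G, hG, rfl⟩).trans (hf G hG)) hK hKφ

end IsDualFamily

end ReducedPointsInChart

theorem two_mul_ceil_half_le (d : ℕ) : 2 * ⌈(d : ℚ) / 2⌉₊ ≤ d + 1 := by
  have h : (⌈(d : ℚ) / 2⌉₊ : ℚ) < d / 2 + 1 := Nat.ceil_lt_add_one (by positivity)
  have h' : (2 * ⌈(d : ℚ) / 2⌉₊ : ℚ) < d + 2 := by linarith
  exact Nat.lt_succ_iff.1 (by exact_mod_cast h')

end Apolarity

theorem mainTheorem7_general {k : Type*} [Field k] {n d m : ℕ} {ι : Type*} [Finite ι]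
    {F : Apolarity.PolyS k n} (hF : F.IsHomogeneous d) (hd : (d.factorial : k) ≠ 0)
    {L : ι → Apolarity.PolyS k n} (hL : ∀ i, (L i).IsHomogeneous 1)
    (hLind : LinearIndependent k L) {Z : Apolarity.ZeroDimScheme k n}
    (hfat : (⨅ i, Apolarity.pointIdeal (L i)) ^ (m + 1) ≤ Z.ideal) (hm : 2 * m ≤ d + 1)
    (hirr : Z.IsIrredundant F) :
    Z.IsRegularInDegree d := by
  cases nonempty_fintype ι
  obtain ⟨y, hy⟩ := Apolarity.exists_isDualFamily hL hLind
  have hZ : Ideal.span (Apolarity.reducedPointsGenerators y L) ^ (m + 1) ≤ Z.ideal :=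
    (Ideal.pow_right_mono (le_iInf hy.span_generators_le_pointIdeal) _).trans hfat
  exact Apolarity.ZeroDimScheme.isRegularInDegree_of_formsInChart_eq_top hy.isHomogeneous_sum
    (hy.isSMulRegular_sum hL Z.saturated hZ)
    (hy.formsInChart_eq_top_of_isIrredundant hL hZ hm hF hd hirr)

theorem mainTheorem7 {k : Type*} [Field k] [IsAlgClosed k] [CharZero k] (n d s : ℕ)
    (F : Apolarity.PolyS k n) (hF : F.IsHomogeneous d)
    (L : Fin s → Apolarity.PolyS k n) (hL : ∀ i, (L i).IsHomogeneous 1)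
    (hLind : LinearIndependent k L)
    (Z : Apolarity.ZeroDimScheme k n) (Zc : Fin s → Apolarity.ZeroDimScheme k n)
    (hZ : Z.ideal = ⨅ i, (Zc i).ideal)
    (hfat : ∀ i, Apolarity.pointIdeal (L i) ^ (⌈(d : ℚ) / 2⌉₊ + 1) ≤ (Zc i).ideal)
    (hirr : Z.IsIrredundant F) :
    Z.IsRegularInDegree d :=
  mainTheorem7_general hF (Nat.cast_ne_zero.2 d.factorial_ne_zero) hL hLind
    (hZ ▸ le_iInf fun i => (Ideal.pow_right_mono (iInf_le _ i) _).trans (hfat i))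
    (Apolarity.two_mul_ceil_half_le d) hirr
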